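/- Let $\mathbb T$ be a compact metric space and $X=(X_t)_{t\in\mathbb T}$ a centered real-valued Gaussian process on a probability space $(\Omega,\mathcal F,\mathbb P)$ with almost surely continuous paths and covariance function $R(t,s)=\mathbb E[X_tX_s]$. Let $\mathbb H_X$ be the reproducing kernel Hilbert space of $R$, i.e. the Hilbert space of functions on $\mathbb T$ obtained by completing the span of the functions $R(t,\cdot)$, $t\in\mathbb T$, with respect to the inner product determined by $(R(t,\cdot),R(s,\cdot))_{\mathbb H_X}=R(t,s)$. Put $\mathbb T_0=\{t\in\mathbb T: X_t=0\text{ a.s.}\}$ and $\mathbb T_1=\mathbb T\setminus\mathbb T_0$. Let $u\colon\mathbb T\to\mathbb R$ be lower semicontinuous, and for functions $g,v\colon\mathbb T\to\mathbb R$ write $$P_{g,u}=\mathbb P\big(\forall t\in\mathbb T:\ X_t+g(t)\le u(t)\big),\qquad P_{0,u,v}=\mathbb P\big(\forall t\in\mathbb T:\ v(t)\le X_t\le u(t)\big).$$ For a finite non-negative Borel measure $\gamma$ on $\mathbb T_1$ write $\mathcal R\gamma(t)=\int_{\mathbb T_1}R(t,s)\,\gamma(ds)$, $t\in\mathbb T$,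 and $\Theta(\gamma,v)=\int_{\mathbb T_1}v\,d\gamma$; for $v=u$ this integral is well defined in $(-\infty,+\infty]$. **Theorem 2.2.** Let $f\in\mathbb H_X$, let $\tilde\gamma$ be a finite non-negative Borel measure on $\mathbb T_1$ (G1), and let $\tilde f=\mathcal R\tilde\gamma$. Then $\tilde f\in\mathbb H_X$, and the following hold. 1. If $\int_{\mathbb T_1}(f-\tilde f)\,d\tilde\gamma\ge0$ (G2), then $$P_{f,u}\le P_{f-\tilde f,u}\,\exp\Big\{-\tfrac12\|\tilde f\|_{\mathbb H_X}^2+\Theta(\tilde\gamma,u)\Big\},$$ where $e^{+\infty}=+\infty$ and $0\cdot(+\infty)=0$. 2. If $u_-\colon\mathbb T\to\mathbb R$ is continuous with $u_-(t)<u(t)$ for all $t\in\mathbb T$ and $P_{0,u,u_-}>0$, and if $\tilde f(t)\ge f(t)$ for all $t\in\mathbb T$ (G3), then $$P_{f,u}\ge P_{0,u,u_-}\,\exp\Big\{-\tfrac12\|\tilde f\|_{\mathbb H_X}^2+\Theta(\tilde\gamma,u_-)\Big\}.$$ -/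

import Mathlib

open MeasureTheory ProbabilityTheory
open scoped ENNReal

/-- A continuous centered real-valued Gaussian process `X = (X t)` on the probability space
`(Ω, P)`, indexed by a topological space `T`; the paths are continuous almost surely. -/
structure ContGaussianProcess (T Ω : Type*) [TopologicalSpace T] [MeasurableSpace Ω]
    (P : Measure Ω) where
  /-- The random variables of the process. -/
  val : T → Ω → ℝ
  gaussian : IsGaussianProcess val P
  centered : ∀ t, ∫ ω, val t ω ∂P = 0
  continuous_paths : ∀ᵐ ω ∂P, Continuous fun t => val t ω

namespace ContGaussianProcess

variable {T Ω : Type*} [TopologicalSpace T] [MeasurableSpace Ω] {P : Measure Ω}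

/-- The covariance function `R(t, s) = E[X_t X_s]` (the process is centered). -/
noncomputable def cov (X : ContGaussianProcess T Ω P) (t s : T) : ℝ :=
  ∫ ω, X.val t ω * X.val s ω ∂P

/-- The covariance function as a kernel with values in the operators on `ℝ`: the entry `(t, s)` is
multiplication by `R(t, s)`. This is the form in which Mathlib builds RKHSs from kernels. -/
noncomputable def covKernel (X : ContGaussianProcess T Ω P) : Matrix T T (ℝ →L[ℝ] ℝ) :=
  Matrix.of fun t s => X.cov t s • (1 : ℝ →L[ℝ] ℝ)

theorem covKernel_apply (X : ContGaussianProcess T Ω P) (t s : T) (v : ℝ) :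
    X.covKernel t s v = X.cov t s * v := by
  simp [covKernel]

theorem integrable_mul (X : ContGaussianProcess T Ω P) (t s : T) :
    Integrable (fun ω => X.val t ω * X.val s ω) P :=
  (X.gaussian.hasGaussianLaw_eval t).memLp_two.integrable_mul
    (X.gaussian.hasGaussianLaw_eval s).memLp_two

theorem posSemidef_covKernel (X : ContGaussianProcess T Ω P) : X.covKernel.PosSemidef := by
  have key := (RKHS.posSemidef_tfae (K := X.covKernel)).out 0 2
  refine key.mpr ⟨?_, fun v => ?_⟩
  · ext t s
    simp [covKernel, Matrix.conjTranspose_apply, cov, mul_comm]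
  · have h : (v.sum fun t a => v.sum fun s b => inner ℝ (X.covKernel s t a) b)
        = ∫ ω, (∑ t ∈ v.support, v t * X.val t ω) ^ 2 ∂P := by
      have e : ∀ ω, (∑ t ∈ v.support, v t * X.val t ω) ^ 2
          = ∑ t ∈ v.support, ∑ s ∈ v.support, (v t * v s) * (X.val s ω * X.val t ω) := by
        intro ω
        rw [sq, Finset.sum_mul_sum]
        exact Finset.sum_congr rfl fun t _ => Finset.sum_congr rfl fun s _ => by ring
      simp_rw [e]
      rw [integral_finsetSum _ fun t _ => integrable_finsetSum _ fun s _ =>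
        (X.integrable_mul s t).const_mul _]
      refine Finset.sum_congr rfl fun t _ => ?_
      rw [integral_finsetSum _ fun s _ => (X.integrable_mul s t).const_mul _]
      refine Finset.sum_congr rfl fun s _ => ?_
      change inner ℝ (X.covKernel s t (v t)) (v s) = _
      rw [integral_const_mul, covKernel_apply, RCLike.inner_apply, cov]
      simp only [conj_trivial]
      ring
    rw [h]
    exact integral_nonneg fun ω => sq_nonneg _

instance fact_posSemidef_covKernel (X : ContGaussianProcess T Ω P) :
    Fact X.covKernel.PosSemidef :=
  ⟨X.posSemidef_covKernel⟩

/-- The reproducing kernel Hilbert space (Cameron-Martin space) of `X`: the completion of the span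
of the functions `R(t, ·)` under `⟪R(t, ·), R(s, ·)⟫ = R(t, s)`. Its elements coerce (injectively)
to functions `T → ℝ`. -/
abbrev HK (X : ContGaussianProcess T Ω P) : Type _ := RKHS.OfKernel X.covKernel

/-- The zero set `T₀` of the process. -/
def zeroSet (X : ContGaussianProcess T Ω P) : Set T := {t | ∀ᵐ ω ∂P, X.val t ω = 0}

/-- `T₁ = T ∖ T₀`. -/
abbrev nonzeroSet (X : ContGaussianProcess T Ω P) : Set T := X.zeroSetᶜ

/-- The covariance operator on (non-negative) measures on `T₁`: `(𝓡 γ)(t) = ∫ R(t, s) γ(ds)`. -/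
noncomputable def covOp [MeasurableSpace T] (X : ContGaussianProcess T Ω P)
    (γ : Measure X.nonzeroSet) (t : T) : ℝ :=
  ∫ s, X.cov t s ∂γ

/-- The boundary non-crossing probability `P_{f,u} = P(∀ t, X_t + f(t) ≤ u(t))`. -/
noncomputable def nonCrossing (X : ContGaussianProcess T Ω P) (f u : T → ℝ) : ℝ≥0∞ :=
  P {ω | ∀ t, X.val t ω + f t ≤ u t}

/-- The two-sided probability `P_{0,u,v} = P(∀ t, v(t) ≤ X_t ≤ u(t))`. -/
noncomputable def nonCrossingTwoSided (X : ContGaussianProcess T Ω P) (u v : T → ℝ) : ℝ≥0∞ :=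
  P {ω | ∀ t, v t ≤ X.val t ω ∧ X.val t ω ≤ u t}

/-- `Θ(γ, v) = ∫_{T₁} v dγ` as an extended real number, `∫ v⁺ dγ - ∫ v⁻ dγ`. A lower semicontinuous
`v` on a compact space is bounded below, so that `∫ v⁻ dγ < ∞` for finite `γ`, but the integral may
be `+∞`. -/
noncomputable def theta [MeasurableSpace T] (X : ContGaussianProcess T Ω P)
    (γ : Measure X.nonzeroSet) (v : T → ℝ) : EReal :=
  ((∫⁻ t, ENNReal.ofReal (v t) ∂γ : ℝ≥0∞) : EReal) -
    ((∫⁻ t, ENNReal.ofReal (-v t) ∂γ : ℝ≥0∞) : EReal)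

end ContGaussianProcess

/-!
The bounds come from the Cameron-Martin formula in the direction of the potential `𝓡 γ`.

For `h` in the Cameron-Martin space with Paley-Wiener integral `Y`, the process `X` has under the
density `exp (Y - ‖h‖² / 2)` the law of `X + h` under `P`. Hence, for continuous `g`,
`P(X + h + g ≤ u) = E[exp (Y - ‖h‖² / 2); X + g ≤ u]` (`IsPaleyWiener.nonCrossing_add`). For
`h = 𝓡 γ`, which is the Bochner integral `∫ R(·, t) dγ(t)` in the Cameron-Martin space, the variable
`Y` is the integral `∫ X_t dγ(t)` of the path (`isPaleyWiener_integral`), so that the density can be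
bounded path by path:

* with `g = f - h`, the event `X + g ≤ u` gives `Y ≤ ∫ (X + g) dγ ≤ Θ(γ, u)` because `∫ g dγ ≥ 0`, and
  this is the upper bound;
* with `g = 0`, on the smaller event `u₋ ≤ X ≤ u` one has `Y ≥ Θ(γ, u₋)`, and `f ≤ h` gives
  `P(X + f ≤ u) ≥ P(X + h ≤ u)`; this is the lower bound.

The Cameron-Martin formula is proved on countably many coordinates, by computing the moment
generating functions of all finite linear combinations (`IsPaleyWiener.map_withDensity`); these are
Gaussian, with variances read off from the isometry `R(·, t) ↦ X_t`. Countably many times suffice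
because an inequality `p ≤ u` with `p` continuous only has to be tested on a set of times over which
the graph of `u` is dense (`exists_countable_forall_le_of_continuous`).
-/

open Filter Topology
open scoped NNReal RealInnerProductSpace

/-! ### Recognizing one-dimensional Gaussian laws -/

/-- Almost sure limits of centered real Gaussian variables with convergent variances are Gaussian. -/
theorem map_eq_gaussianReal_of_tendsto_ae {Ω : Type*} [MeasurableSpace Ω] {P : Measure Ω}
    [IsProbabilityMeasure P] {Y : ℕ → Ω → ℝ} {Z : Ω → ℝ} {v : ℕ → ℝ≥0} {w : ℝ≥0}
    (hY : ∀ n, P.map (Y n) = gaussianReal 0 (v n)) (hv : Tendsto v atTop (𝓝 w))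
    (hZ : ∀ᵐ ω ∂P, Tendsto (fun n => Y n ω) atTop (𝓝 (Z ω))) :
    P.map Z = gaussianReal 0 w := by
  have hYm : ∀ n, AEMeasurable (Y n) P := fun n =>
    aemeasurable_of_map_neZero (by rw [hY n]; infer_instance)
  have hZm : AEMeasurable Z P := aemeasurable_of_tendsto_metrizable_ae atTop hYm hZ
  have : IsProbabilityMeasure (P.map Z) := Measure.isProbabilityMeasure_map hZm
  refine Measure.ext_of_charFun (funext fun s => ?_)
  have h1 : ∀ n, ∫ ω, Complex.exp (s * Y n ω * Complex.I) ∂P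
      = Complex.exp (- (v n) * s ^ 2 / 2) := fun n => by
    rw [← integral_map (f := fun x : ℝ => Complex.exp (s * x * Complex.I)) (hYm n) (by fun_prop),
      ← charFun_apply_real, hY, charFun_gaussianReal]
    congr 1
    push_cast
    ring
  have h2 : Tendsto (fun n => ∫ ω, Complex.exp (s * Y n ω * Complex.I) ∂P) atTop
      (𝓝 (∫ ω, Complex.exp (s * Z ω * Complex.I) ∂P)) := by
    refine tendsto_integral_of_dominated_convergence (fun _ => 1)
      (fun n => ?_) (integrable_const 1) (fun n => ae_of_all _ fun ω => ?_) ?_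
    · have := hYm n
      exact (by fun_prop : AEMeasurable _ P).aestronglyMeasurable
    · rw [← Complex.ofReal_mul, Complex.norm_exp_ofReal_mul_I]
    · filter_upwards [hZ] with ω hω
      exact (Complex.continuous_exp.tendsto _).comp
        (((Complex.continuous_ofReal.tendsto _).comp hω).const_mul _ |>.mul_const _)
  have h3 : Tendsto (fun n => Complex.exp (- (v n) * s ^ 2 / 2)) atTop
      (𝓝 (Complex.exp (- w * s ^ 2 / 2))) := by
    have hc : Continuous fun x : ℝ≥0 => Complex.exp (- (x : ℂ) * s ^ 2 / 2) := by
      have : Continuous fun x : ℝ≥0 => (((x : ℝ) : ℂ)) :=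
        Complex.continuous_ofReal.comp NNReal.continuous_coe
      have h' : Continuous fun x : ℝ≥0 => Complex.exp (- ((x : ℝ) : ℂ) * s ^ 2 / 2) := by
        fun_prop
      exact h'
    exact (hc.tendsto w).comp hv
  simp_rw [h1] at h2
  rw [charFun_apply_real, integral_map hZm (by fun_prop), tendsto_nhds_unique h2 h3,
    charFun_gaussianReal]
  congr 1
  push_cast
  ring

/-- A real variable with the moment generating function of a Gaussian law has that law. -/
theorem map_eq_gaussianReal_of_mgf {Ω : Type*} [MeasurableSpace Ω] {Q : Measure Ω}
    [IsFiniteMeasure Q] {Z : Ω → ℝ} (hZ : AEMeasurable Z Q) {m : ℝ} {v : ℝ≥0}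
    (h : ∀ s, mgf Z Q s = Real.exp (m * s + v * s ^ 2 / 2)) :
    Q.map Z = gaussianReal m v := by
  have h1 : mgf id (gaussianReal m v) = mgf Z Q := by
    rw [mgf_id_gaussianReal]
    exact (funext h).symm
  have h2 := eqOn_complexMGF_of_mgf h1
  rw [integrableExpSet_id_gaussianReal, interior_univ] at h2
  have h3 : complexMGF Z Q = complexMGF id (gaussianReal m v) :=
    funext fun z => (h2 (Set.mem_univ _)).symm
  simpa using Measure.ext_of_complexMGF_eq hZ aemeasurable_id h3

namespace ContGaussianProcess

variable {T Ω : Type*} [TopologicalSpace T] [MeasurableSpace Ω] {P : Measure Ω}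

/-! ### The isometry between the process and its Cameron-Martin space -/

/-- The element `R(·, t)` of the Cameron-Martin space, which represents the evaluation at `t`. -/
noncomputable def covSection (X : ContGaussianProcess T Ω P) (t : T) : X.HK :=
  RKHS.kerFun X.HK t 1

theorem cov_comm (X : ContGaussianProcess T Ω P) (t s : T) : X.cov t s = X.cov s t := by
  simp_rw [cov, mul_comm (X.val t _)]

theorem inner_covSection (X : ContGaussianProcess T Ω P) (f : X.HK) (t : T) :
    ⟪f, X.covSection t⟫ = f t := by
  rw [covSection, RKHS.inner_kerFun]
  simp

theorem covSection_apply (X : ContGaussianProcess T Ω P) (t s : T) :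
    X.covSection t s = X.cov s t := by
  rw [covSection, RKHS.kerFun_apply, RKHS.OfKernel.kernel_ofKernel, covKernel_apply, mul_one]

/-- The random variable `∑ c_t X_t` attached to a finitely supported family of coefficients. -/
noncomputable def linComb (X : ContGaussianProcess T Ω P) (a : T →₀ ℝ) (ω : Ω) : ℝ :=
  a.sum fun t c => c * X.val t ω

/-- The element `∑ c_t R(·, t)` of the Cameron-Martin space. -/
noncomputable def covComb (X : ContGaussianProcess T Ω P) (a : T →₀ ℝ) : X.HK :=
  a.sum fun t c => c • X.covSection t

theorem linComb_single (X : ContGaussianProcess T Ω P) (t : T) (c : ℝ) (ω : Ω) :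
    X.linComb (Finsupp.single t c) ω = c * X.val t ω :=
  Finsupp.sum_single_index (by simp)

theorem covComb_single (X : ContGaussianProcess T Ω P) (t : T) (c : ℝ) :
    X.covComb (Finsupp.single t c) = c • X.covSection t :=
  Finsupp.sum_single_index (by simp)

theorem linComb_add (X : ContGaussianProcess T Ω P) (a b : T →₀ ℝ) (ω : Ω) :
    X.linComb (a + b) ω = X.linComb a ω + X.linComb b ω :=
  Finsupp.sum_add_index' (by simp) (by intros; ring)

theorem linComb_smul (X : ContGaussianProcess T Ω P) (r : ℝ) (a : T →₀ ℝ) (ω : Ω) :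
    X.linComb (r • a) ω = r * X.linComb a ω := by
  rw [linComb, Finsupp.sum_smul_index (by simp), linComb, Finsupp.mul_sum]
  simp [mul_assoc]

theorem covComb_add (X : ContGaussianProcess T Ω P) (a b : T →₀ ℝ) :
    X.covComb (a + b) = X.covComb a + X.covComb b :=
  Finsupp.sum_add_index' (by simp) (by intros; rw [add_smul])

theorem covComb_smul (X : ContGaussianProcess T Ω P) (r : ℝ) (a : T →₀ ℝ) :
    X.covComb (r • a) = r • X.covComb a := by
  rw [covComb, Finsupp.sum_smul_index (by simp), covComb, Finsupp.smul_sum]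
  simp [smul_smul]

theorem inner_covComb (X : ContGaussianProcess T Ω P) (f : X.HK) (a : T →₀ ℝ) :
    ⟪f, X.covComb a⟫ = a.sum fun t c => c * f t := by
  rw [covComb, Finsupp.inner_sum]
  simp [Finsupp.sum, inner_smul_right, inner_covSection]

theorem aemeasurable_val (X : ContGaussianProcess T Ω P) (t : T) : AEMeasurable (X.val t) P :=
  X.gaussian.aemeasurable t

theorem hasGaussianLaw_linComb (X : ContGaussianProcess T Ω P) (a : T →₀ ℝ) :
    HasGaussianLaw (X.linComb a) P := by
  have h := (X.gaussian.hasGaussianLaw a.support).map_fun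
    (∑ i : a.support, a i • ContinuousLinearMap.proj (R := ℝ) (φ := fun _ : a.support => ℝ) i)
  refine h.congr (ae_of_all _ fun ω => ?_)
  simp only [linComb, Finsupp.sum, _root_.sum_apply, _root_.smul_apply,
    ContinuousLinearMap.proj_apply, Finset.restrict, smul_eq_mul]
  exact Finset.sum_coe_sort a.support fun t => a t * X.val t ω

/-- `∑ c_t R(·, t) ↦ ∑ c_t X_t` is an isometry into `L²(P)`. -/
theorem integral_linComb_sq (X : ContGaussianProcess T Ω P) (a : T →₀ ℝ) :
    ∫ ω, X.linComb a ω ^ 2 ∂P = ‖X.covComb a‖ ^ 2 := by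
  have e : ∀ ω, X.linComb a ω ^ 2
      = ∑ t ∈ a.support, ∑ s ∈ a.support, (a t * a s) * (X.val t ω * X.val s ω) := by
    intro ω
    rw [linComb, Finsupp.sum, sq, Finset.sum_mul_sum]
    exact Finset.sum_congr rfl fun t _ => Finset.sum_congr rfl fun s _ => by ring
  simp_rw [e]
  rw [integral_finsetSum _ fun t _ => integrable_finsetSum _ fun s _ =>
    (X.integrable_mul t s).const_mul _, ← real_inner_self_eq_norm_sq, inner_covComb, Finsupp.sum]
  refine Finset.sum_congr rfl fun t _ => ?_
  rw [integral_finsetSum _ fun s _ => (X.integrable_mul t s).const_mul _, ← inner_covSection,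
    real_inner_comm, inner_covComb, Finsupp.sum, Finset.mul_sum]
  refine Finset.sum_congr rfl fun s _ => ?_
  rw [integral_const_mul, covSection_apply, cov_comm, cov, mul_assoc]

theorem map_linComb (X : ContGaussianProcess T Ω P) (a : T →₀ ℝ) :
    P.map (X.linComb a) = gaussianReal 0 (‖X.covComb a‖₊ ^ 2) := by
  have hm : ∫ ω, X.linComb a ω ∂P = 0 := by
    simp only [linComb, Finsupp.sum]
    rw [integral_finsetSum _ fun t _ =>
      (X.gaussian.hasGaussianLaw_eval t).integrable.const_mul _]
    simp [integral_const_mul, X.centered]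
  rw [(X.hasGaussianLaw_linComb a).map_eq_gaussianReal, hm,
    variance_of_integral_eq_zero (X.hasGaussianLaw_linComb a).aemeasurable hm,
    X.integral_linComb_sq a]
  congr 1
  ext
  rw [Real.coe_toNNReal _ (by positivity)]
  simp

/-- Almost sure continuity of the paths gives convergence of `X_s` to `X_t` in probability, which for
Gaussian variables forces the variance of `X_s - X_t` to vanish in the limit. -/
theorem continuous_covSection [FirstCountableTopology T] (X : ContGaussianProcess T Ω P) :
    Continuous X.covSection := by
  have := X.gaussian.isProbabilityMeasure
  refine continuous_iff_continuousAt.2 fun t => ?_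
  have hlaw : ∀ s, ∫ ω, Complex.exp ((X.val s ω - X.val t ω : ℝ) * Complex.I) ∂P
      = Complex.exp ((-(‖X.covSection s - X.covSection t‖ ^ 2 / 2) : ℝ)) := fun s => by
    have h := X.map_linComb (Finsupp.single s 1 + Finsupp.single t (-1))
    have e1 : X.linComb (Finsupp.single s 1 + Finsupp.single t (-1))
        = fun ω => X.val s ω - X.val t ω := by
      ext ω
      rw [linComb_add, linComb_single, linComb_single]
      ring
    have e2 : X.covComb (Finsupp.single s 1 + Finsupp.single t (-1))
        = X.covSection s - X.covSection t := by
      rw [covComb_add, covComb_single, covComb_single, one_smul, neg_one_smul, sub_eq_add_neg]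
    rw [e1, e2] at h
    have hm : AEMeasurable (fun ω => X.val s ω - X.val t ω) P :=
      (X.aemeasurable_val s).sub (X.aemeasurable_val t)
    rw [← integral_map (f := fun x : ℝ => Complex.exp (x * Complex.I)) hm (by fun_prop)]
    have h' := charFun_apply_real (μ := P.map fun ω => X.val s ω - X.val t ω) 1
    simp only [Complex.ofReal_one, one_mul] at h'
    rw [← h', h, charFun_gaussianReal]
    congr 1
    push_cast
    ring
  have hlim : Tendsto (fun s => ∫ ω, Complex.exp ((X.val s ω - X.val t ω : ℝ) * Complex.I) ∂P)
      (𝓝 t) (𝓝 (∫ ω, (1 : ℂ) ∂P)) := by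
    refine tendsto_integral_filter_of_dominated_convergence (fun _ => 1)
      (Eventually.of_forall fun s => ?_)
      (Eventually.of_forall fun s => ae_of_all _ fun ω => ?_) (integrable_const 1) ?_
    · have h1 := X.aemeasurable_val s
      have h2 := X.aemeasurable_val t
      exact (by fun_prop : AEMeasurable _ P).aestronglyMeasurable
    · rw [Complex.norm_exp_ofReal_mul_I]
    · filter_upwards [X.continuous_paths] with ω hω
      have hc : Continuous fun s => Complex.exp ((X.val s ω - X.val t ω : ℝ) * Complex.I) := by
        fun_prop
      simpa using hc.tendsto t
  simp_rw [hlaw] at hlim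
  have h4 := hlim.norm
  simp only [Complex.norm_exp_ofReal, integral_const, probReal_univ, one_smul, norm_one] at h4
  have h5 := h4.log one_ne_zero
  simp only [Real.log_exp, Real.log_one] at h5
  have h6 : Tendsto (fun s => ‖X.covSection s - X.covSection t‖ ^ 2) (𝓝 t) (𝓝 0) := by
    have := h5.const_mul (-2)
    simp only [mul_zero] at this
    refine this.congr fun s => by ring
  have h7 := h6.sqrt
  simp only [Real.sqrt_sq (norm_nonneg _), Real.sqrt_zero] at h7
  exact tendsto_iff_norm_sub_tendsto_zero.2 h7

theorem continuous_coe_HK [FirstCountableTopology T] (X : ContGaussianProcess T Ω P) (f : X.HK) :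
    Continuous f := by
  have h : (f : T → ℝ) = fun t => ⟪f, X.covSection t⟫ := funext fun t =>
    (X.inner_covSection f t).symm
  rw [h]
  exact continuous_const.inner X.continuous_covSection

/-! ### The Cameron-Martin formula -/

/-- `Y` is a version of the Paley-Wiener integral of `h`: the value at `h` of the isometry sending
`R(·, t)` to `X_t`. Encoded through a sequence of finite linear combinations that converges to `h` in
the Cameron-Martin space while the random variables converge to `Y` almost surely. -/
def IsPaleyWiener (X : ContGaussianProcess T Ω P) (h : X.HK) (Y : Ω → ℝ) : Prop :=
  ∃ a : ℕ → T →₀ ℝ, Tendsto (fun n => X.covComb (a n)) atTop (𝓝 h) ∧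
    ∀ᵐ ω ∂P, Tendsto (fun n => X.linComb (a n) ω) atTop (𝓝 (Y ω))

namespace IsPaleyWiener

variable {X : ContGaussianProcess T Ω P} {h : X.HK} {Y : Ω → ℝ}

theorem linComb_add (hY : X.IsPaleyWiener h Y) (b : T →₀ ℝ) :
    X.IsPaleyWiener (X.covComb b + h) (fun ω => X.linComb b ω + Y ω) := by
  obtain ⟨a, ha, hl⟩ := hY
  refine ⟨fun n => b + a n, ?_, ?_⟩
  · simp_rw [covComb_add]
    exact ha.const_add _
  · filter_upwards [hl] with ω hω
    simp_rw [ContGaussianProcess.linComb_add]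
    exact hω.const_add _

theorem map_eq (hY : X.IsPaleyWiener h Y) : P.map Y = gaussianReal 0 (‖h‖₊ ^ 2) := by
  have := X.gaussian.isProbabilityMeasure
  obtain ⟨a, ha, hl⟩ := hY
  exact map_eq_gaussianReal_of_tendsto_ae (fun n => X.map_linComb (a n)) (ha.nnnorm.pow 2) hl

theorem aemeasurable (hY : X.IsPaleyWiener h Y) : AEMeasurable Y P :=
  aemeasurable_of_map_neZero (by rw [hY.map_eq]; infer_instance)

theorem integral_exp (hY : X.IsPaleyWiener h Y) :
    ∫ ω, Real.exp (Y ω) ∂P = Real.exp (‖h‖ ^ 2 / 2) := by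
  have h1 := mgf_gaussianReal hY.map_eq 1
  simpa [mgf] using h1

theorem integrable_exp (hY : X.IsPaleyWiener h Y) : Integrable (fun ω => Real.exp (Y ω)) P := by
  have h1 := integrable_exp_mul_gaussianReal (μ := 0) (v := ‖h‖₊ ^ 2) 1
  rw [← hY.map_eq] at h1
  simpa [Function.comp_def] using h1.comp_aemeasurable hY.aemeasurable

end IsPaleyWiener

/-- The Cameron-Martin density `exp (Y - ‖h‖² / 2)`. -/
noncomputable def cmDensity (X : ContGaussianProcess T Ω P) (h : X.HK) (Y : Ω → ℝ) (ω : Ω) :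
    ℝ≥0∞ :=
  ENNReal.ofReal (Real.exp (Y ω - ‖h‖ ^ 2 / 2))

theorem cmDensity_eq_exp (X : ContGaussianProcess T Ω P) (h : X.HK) (Y : Ω → ℝ) (ω : Ω) :
    X.cmDensity h Y ω = EReal.exp (((-(1 / 2) * ‖h‖ ^ 2 : ℝ) : EReal) + (Y ω : ℝ)) := by
  rw [← EReal.coe_add, EReal.exp_coe, cmDensity]
  congr 2
  ring

namespace IsPaleyWiener

variable {X : ContGaussianProcess T Ω P} {h : X.HK} {Y : Ω → ℝ}

theorem aemeasurable_cmDensity (hY : X.IsPaleyWiener h Y) : AEMeasurable (X.cmDensity h Y) P := by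
  have := hY.aemeasurable
  unfold cmDensity
  fun_prop

theorem isFiniteMeasure_withDensity (hY : X.IsPaleyWiener h Y) :
    IsFiniteMeasure (P.withDensity (X.cmDensity h Y)) := by
  refine isFiniteMeasure_withDensity_ofReal (Integrable.hasFiniteIntegral ?_)
  simp_rw [sub_eq_add_neg, Real.exp_add]
  exact hY.integrable_exp.mul_const _

/-- One-dimensional form of the Cameron-Martin formula: under the tilted measure a linear combination
of the process is shifted by its covariance with `Y`. -/
theorem map_linComb_withDensity (hY : X.IsPaleyWiener h Y) (a : T →₀ ℝ) :
    (P.withDensity (X.cmDensity h Y)).map (X.linComb a)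
      = P.map (fun ω => X.linComb a ω + ⟪h, X.covComb a⟫) := by
  have := hY.isFiniteMeasure_withDensity
  have hm := (X.hasGaussianLaw_linComb a).aemeasurable
  have hd : AEMeasurable (fun ω => Real.exp (Y ω - ‖h‖ ^ 2 / 2)) P := by
    have := hY.aemeasurable
    fun_prop
  have h1 : P.map (fun ω => X.linComb a ω + ⟪h, X.covComb a⟫)
      = gaussianReal ⟪h, X.covComb a⟫ (‖X.covComb a‖₊ ^ 2) := by
    have := gaussianReal_add_const (HasLaw.mk hm (X.map_linComb a)) ⟪h, X.covComb a⟫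
    simpa using this.map_eq
  rw [h1]
  refine map_eq_gaussianReal_of_mgf (hm.mono_ac (withDensity_absolutelyContinuous _ _)) fun s => ?_
  -- The moment generating function at `s` is an exponential moment of `s ∑ c_t X_t + Y`, itself the
  -- Paley-Wiener integral of `s ∑ c_t R(·, t) + h`.
  rw [mgf]
  unfold cmDensity
  rw [integral_withDensity_eq_integral_toReal_smul₀ hd.ennreal_ofReal
    (ae_of_all _ fun _ => ENNReal.ofReal_lt_top)]
  have e : ∀ ω, (ENNReal.ofReal (Real.exp (Y ω - ‖h‖ ^ 2 / 2))).toReal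
        • Real.exp (s * X.linComb a ω)
      = Real.exp (-(‖h‖ ^ 2 / 2)) * Real.exp (X.linComb (s • a) ω + Y ω) := fun ω => by
    rw [ENNReal.toReal_ofReal (Real.exp_pos _).le, smul_eq_mul, ← Real.exp_add, ← Real.exp_add,
      linComb_smul]
    congr 1
    ring
  simp_rw [e]
  rw [integral_const_mul, (hY.linComb_add (s • a)).integral_exp, ← Real.exp_add,
    norm_add_sq_real, covComb_smul, norm_smul, real_inner_smul_left, real_inner_comm]
  congr 1
  simp only [Real.norm_eq_abs, mul_pow, sq_abs, NNReal.coe_pow, coe_nnnorm]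
  ring

/-- The Cameron-Martin formula on countably many coordinates: under the density
`exp (Y - ‖h‖² / 2)` the process `X` has the law of `X + h`. -/
theorem map_withDensity (hY : X.IsPaleyWiener h Y) (D : Set T) [Countable D] :
    (P.withDensity (X.cmDensity h Y)).map (fun ω (t : D) => X.val t ω)
      = P.map (fun ω (t : D) => X.val t ω + h t) := by
  classical
  have := X.gaussian.isProbabilityMeasure
  have := hY.isFiniteMeasure_withDensity
  set Q := P.withDensity (X.cmDensity h Y) with hQ
  have hac : Q ≪ P := withDensity_absolutelyContinuous _ _
  have m1 : AEMeasurable (fun ω (t : D) => X.val t ω) P :=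
    aemeasurable_pi_lambda _ fun t => X.aemeasurable_val t
  have m2 : AEMeasurable (fun ω (t : D) => X.val t ω + h t) P :=
    aemeasurable_pi_lambda _ fun t => (X.aemeasurable_val t).add_const _
  refine IsProjectiveLimit.unique
    (P := fun J => (P.map (fun ω (t : D) => X.val t ω + h t)).map J.restrict) (fun J => ?_)
    (fun J => rfl)
  refine Measure.ext_of_charFunDual (funext fun L => ?_)
  -- A linear functional of finitely many coordinates is a linear combination of the process, so the
  -- one-dimensional formula determines all finite-dimensional laws.
  set a : T →₀ ℝ := ∑ j : J, Finsupp.single ((j : D) : T) (L (Pi.single j 1)) with ha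
  have hL : ∀ x : J → ℝ, L x = ∑ j, L (Pi.single j 1) * x j := fun x => by
    conv_lhs => rw [← Finset.univ_sum_single x]
    rw [map_sum]
    refine Finset.sum_congr rfl fun j _ => ?_
    rw [mul_comm, ← smul_eq_mul (x j), ← map_smul, ← Pi.single_smul, smul_eq_mul, mul_one]
  have hsum : ∀ g : T → ℝ, (a.sum fun t c => c * g t) = ∑ j : J, L (Pi.single j 1) * g j :=
    fun g => by
      rw [ha, ← Finsupp.sum_finsetSum_index (by simp) (by intros; ring)]
      simp
  have e1 : (fun ω => L (J.restrict fun t : D => X.val t ω)) = X.linComb a := by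
    ext ω
    rw [linComb, hsum, hL]
    rfl
  have e2 : (fun ω => L (J.restrict fun t : D => X.val t ω + h t))
      = fun ω => X.linComb a ω + ⟪h, X.covComb a⟫ := by
    ext ω
    rw [linComb, inner_covComb, hsum, hsum, hL, ← Finset.sum_add_distrib]
    exact Finset.sum_congr rfl fun j _ => by rw [← mul_add]; rfl
  have hJ : Measurable (J.restrict (π := fun _ : D => ℝ)) := Finset.measurable_restrict J
  have hLm : Measurable (L : (J → ℝ) → ℝ) := L.continuous.measurable
  rw [charFunDual_eq_charFun_map_one, charFunDual_eq_charFun_map_one,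
    Measure.map_map hLm hJ, Measure.map_map hLm hJ,
    AEMeasurable.map_map_of_aemeasurable (hLm.comp hJ).aemeasurable (m1.mono_ac hac),
    AEMeasurable.map_map_of_aemeasurable (hLm.comp hJ).aemeasurable m2]
  change charFun (Q.map fun ω => L (J.restrict fun t : D => X.val t ω)) 1
    = charFun (P.map fun ω => L (J.restrict fun t : D => X.val t ω + h t)) 1
  rw [e1, e2, hY.map_linComb_withDensity]

end IsPaleyWiener

end ContGaussianProcess

/-! ### Reduction of the boundary constraint to countably many times -/

/-- An upper bound `p ≤ u` on a continuous function is determined by countably many points, even when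
`u` is not continuous: the points are chosen so that the graph of `u` over them is dense in the
graph of `u`. -/
theorem exists_countable_forall_le_of_continuous {T : Type*} [TopologicalSpace T]
    [SecondCountableTopology T] (u : T → ℝ) :
    ∃ D : Set T, D.Countable ∧
      ∀ p : T → ℝ, Continuous p → (∀ t ∈ D, p t ≤ u t) → ∀ t, p t ≤ u t := by
  obtain ⟨s, hsc, hsd⟩ :=
    TopologicalSpace.exists_countable_dense (Set.range fun t => (t, u t))
  refine ⟨(fun x => x.1.1) '' s, hsc.image _, fun p hp h t => ?_⟩
  have hcl : IsClosed {x : Set.range fun t => (t, u t) | p x.1.1 ≤ x.1.2} :=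
    isClosed_le (by fun_prop) (by fun_prop)
  have hsub : s ⊆ {x : Set.range fun t => (t, u t) | p x.1.1 ≤ x.1.2} := by
    rintro ⟨_, r, rfl⟩ hx
    exact h r ⟨_, hx, rfl⟩
  have huniv := hcl.closure_subset_iff.2 hsub
  rw [hsd.closure_eq] at huniv
  exact huniv (Set.mem_univ ⟨(t, u t), t, rfl⟩)

/-! ### Riemann sums along simple functions -/

theorem integrable_comp_of_continuous_of_compact {S T E : Type*} [MetricSpace T] [CompactSpace T]
    [MeasurableSpace T] [BorelSpace T] [MeasurableSpace S] [NormedAddCommGroup E]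
    (γ : Measure S) [IsFiniteMeasure γ] {φ : S → T} (hφ : Measurable φ) {F : T → E}
    (hF : Continuous F) : Integrable (fun s => F (φ s)) γ := by
  obtain ⟨C, hC⟩ := isCompact_univ.exists_bound_of_continuousOn hF.continuousOn
  exact Integrable.of_bound (hF.stronglyMeasurable.comp_measurable hφ).aestronglyMeasurable C
    (ae_of_all _ fun s => hC _ (Set.mem_univ _))

theorem integral_comp_simpleFunc {S T E : Type*} [MeasurableSpace S] [NormedAddCommGroup E]
    [NormedSpace ℝ E] [CompleteSpace E] (γ : Measure S) [IsFiniteMeasure γ] (σ : SimpleFunc S T)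
    (F : T → E) :
    ∫ s, F (σ s) ∂γ = ∑ x ∈ σ.range, γ.real (σ ⁻¹' {x}) • F x := by
  have e : ∀ s, F (σ s) = ∑ x ∈ σ.range, (σ ⁻¹' {x}).indicator (fun _ => F x) s := fun s => by
    rw [Finset.sum_eq_single_of_mem (σ s) (σ.mem_range_self s)]
    · simp
    · intro x _ hx
      exact Set.indicator_of_notMem (fun h => hx h.symm) _
  simp_rw [e]
  rw [integral_finsetSum _ fun x _ =>
    (integrable_const (F x)).indicator (σ.measurableSet_fiber x)]
  exact Finset.sum_congr rfl fun x _ => integral_indicator_const _ (σ.measurableSet_fiber x)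

theorem tendsto_integral_comp_of_tendsto {S T E : Type*} [TopologicalSpace T] [CompactSpace T]
    [MeasurableSpace S] [NormedAddCommGroup E] [NormedSpace ℝ E]
    (γ : Measure S) [IsFiniteMeasure γ] {φ : S → T} {σ : ℕ → SimpleFunc S T}
    (hσ : ∀ s, Tendsto (fun n => σ n s) atTop (𝓝 (φ s))) {F : T → E} (hF : Continuous F) :
    Tendsto (fun n => ∫ s, F (σ n s) ∂γ) atTop (𝓝 (∫ s, F (φ s) ∂γ)) := by
  obtain ⟨C, hC⟩ := isCompact_univ.exists_bound_of_continuousOn hF.continuousOn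
  exact tendsto_integral_of_dominated_convergence (fun _ => C)
    (fun n => ((σ n).map F).stronglyMeasurable.aestronglyMeasurable) (integrable_const C)
    (fun n => ae_of_all _ fun s => hC _ (Set.mem_univ _))
    (ae_of_all _ fun s => (hF.tendsto _).comp (hσ s))

namespace ContGaussianProcess

section Events

variable {T Ω : Type*} [TopologicalSpace T] [SecondCountableTopology T] [MeasurableSpace Ω]
  {P : Measure Ω}

theorem exists_countable_nonCrossing_ae_eq (X : ContGaussianProcess T Ω P) (u : T → ℝ) :
    ∃ D : Set T, D.Countable ∧ ∀ g : T → ℝ, Continuous g →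
      {ω | ∀ t, X.val t ω + g t ≤ u t} =ᵐ[P]
        (fun ω (t : D) => X.val t ω + g t) ⁻¹' {x | ∀ t : D, x t ≤ u t} := by
  obtain ⟨D, hD, h⟩ := exists_countable_forall_le_of_continuous u
  refine ⟨D, hD, fun g hg => eventuallyEq_set.2 ?_⟩
  filter_upwards [X.continuous_paths] with ω hω
  exact ⟨fun H t => H t, fun H => h _ (hω.add hg) fun t ht => H ⟨t, ht⟩⟩

theorem nullMeasurableSet_nonCrossing (X : ContGaussianProcess T Ω P) (u : T → ℝ) {g : T → ℝ}
    (hg : Continuous g) : NullMeasurableSet {ω | ∀ t, X.val t ω + g t ≤ u t} P := by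
  obtain ⟨D, hD, h⟩ := X.exists_countable_nonCrossing_ae_eq u
  have := hD.to_subtype
  refine NullMeasurableSet.congr ?_ (h g hg).symm
  refine (aemeasurable_pi_lambda _ fun t : D =>
    (X.aemeasurable_val t).add_const (g t)).nullMeasurableSet_preimage ?_
  exact measurableSet_setOfPred.2 <| Measurable.forall fun t =>
    measurableSet_setOfPred.1 (measurableSet_le (measurable_pi_apply t) measurable_const)

/-- The Cameron-Martin formula for boundary non-crossing probabilities. -/
theorem IsPaleyWiener.nonCrossing_add {X : ContGaussianProcess T Ω P} {h : X.HK} {Y : Ω → ℝ}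
    (hY : X.IsPaleyWiener h Y) (u : T → ℝ) {g : T → ℝ} (hg : Continuous g) :
    X.nonCrossing (h + g) u
      = ∫⁻ ω in {ω | ∀ t, X.val t ω + g t ≤ u t}, X.cmDensity h Y ω ∂P := by
  have hh : Continuous h := X.continuous_coe_HK h
  obtain ⟨D, hD, hae⟩ := X.exists_countable_nonCrossing_ae_eq u
  have := hD.to_subtype
  set B : Set (D → ℝ) := {x | ∀ t : D, x t + g t ≤ u t} with hB
  have hBm : MeasurableSet B := measurableSet_setOfPred.2 <| Measurable.forall fun t =>
    measurableSet_setOfPred.1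
      (measurableSet_le ((measurable_pi_apply t).add_const _) measurable_const)
  have hac : P.withDensity (X.cmDensity h Y) ≪ P := withDensity_absolutelyContinuous _ _
  have m1 : AEMeasurable (fun ω (t : D) => X.val t ω) P :=
    aemeasurable_pi_lambda _ fun t => X.aemeasurable_val t
  have m2 : AEMeasurable (fun ω (t : D) => X.val t ω + h t) P :=
    aemeasurable_pi_lambda _ fun t => (X.aemeasurable_val t).add_const _
  calc X.nonCrossing (h + g) u
      = P ((fun ω (t : D) => X.val t ω + h t) ⁻¹' B) := by
        refine (measure_congr (hae (h + g) (hh.add hg))).trans (congrArg P ?_)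
        ext ω
        simp [hB, add_assoc]
    _ = P.withDensity (X.cmDensity h Y) ((fun ω (t : D) => X.val t ω) ⁻¹' B) := by
        rw [← Measure.map_apply_of_aemeasurable m2 hBm,
          ← Measure.map_apply_of_aemeasurable (m1.mono_ac hac) hBm, hY.map_withDensity]
    _ = P.withDensity (X.cmDensity h Y) {ω | ∀ t, X.val t ω + g t ≤ u t} :=
        (measure_congr (hac.ae_eq (hae g hg))).symm
    _ = _ := withDensity_apply₀ _ (X.nullMeasurableSet_nonCrossing u hg)

end Events

/-! ### Potentials of measures as Paley-Wiener integrals -/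

section Potential

variable {T Ω S : Type*} [MetricSpace T] [CompactSpace T] [MeasurableSpace T] [BorelSpace T]
  [MeasurableSpace Ω] [MeasurableSpace S] {P : Measure Ω}

/-- The integral of the paths against a finite measure is the Paley-Wiener integral of the potential
of that measure: Riemann sums along simple functions converge to both. -/
theorem isPaleyWiener_integral (X : ContGaussianProcess T Ω P) (γ : Measure S)
    [IsFiniteMeasure γ] {φ : S → T} (hφ : Measurable φ) :
    X.IsPaleyWiener (∫ s, X.covSection (φ s) ∂γ) (fun ω => ∫ s, X.val (φ s) ω ∂γ) := by
  rcases isEmpty_or_nonempty T with hT | ⟨⟨t₀⟩⟩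
  · have : IsEmpty S := φ.isEmpty
    refine ⟨fun _ => 0, ?_, ae_of_all _ fun ω => ?_⟩ <;>
      simp [covComb, linComb, Measure.eq_zero_of_isEmpty γ]
  set σ : ℕ → SimpleFunc S T := SimpleFunc.approxOn φ hφ Set.univ t₀ (Set.mem_univ _)
  have hσ : ∀ s, Tendsto (fun n => σ n s) atTop (𝓝 (φ s)) := fun s =>
    SimpleFunc.tendsto_approxOn hφ (Set.mem_univ _) (by simp)
  set a : ℕ → T →₀ ℝ := fun n =>
    ∑ x ∈ (σ n).range, Finsupp.single x (γ.real (σ n ⁻¹' {x})) with ha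
  have hcov : ∀ n, X.covComb (a n) = ∫ s, X.covSection (σ n s) ∂γ := fun n => by
    rw [integral_comp_simpleFunc, ha, covComb,
      ← Finsupp.sum_finsetSum_index (by simp) (by intros; rw [add_smul])]
    simp
  have hlin : ∀ n ω, X.linComb (a n) ω = ∫ s, X.val (σ n s) ω ∂γ := fun n ω => by
    rw [integral_comp_simpleFunc γ (σ n) fun t => X.val t ω, ha, linComb,
      ← Finsupp.sum_finsetSum_index (by simp) (by intros; ring)]
    simp
  refine ⟨a, ?_, ?_⟩
  · simp_rw [hcov]
    exact tendsto_integral_comp_of_tendsto γ hσ X.continuous_covSection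
  · filter_upwards [X.continuous_paths] with ω hω
    simp_rw [hlin]
    exact tendsto_integral_comp_of_tendsto γ hσ hω

end Potential

/-! ### The functional `Θ` -/

section Theta

variable {T Ω : Type*} [TopologicalSpace T] [MeasurableSpace T] [MeasurableSpace Ω]
  {P : Measure Ω}

theorem theta_mono (X : ContGaussianProcess T Ω P) (γ : Measure X.nonzeroSet) {v w : T → ℝ}
    (h : ∀ t, v t ≤ w t) : X.theta γ v ≤ X.theta γ w := by
  refine EReal.sub_le_sub ?_ ?_ <;> refine EReal.coe_ennreal_le_coe_ennreal_iff.2 ?_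
  · exact lintegral_mono fun t => ENNReal.ofReal_le_ofReal (h t)
  · exact lintegral_mono fun t => ENNReal.ofReal_le_ofReal (neg_le_neg (h t))

theorem theta_eq_integral (X : ContGaussianProcess T Ω P) (γ : Measure X.nonzeroSet) {v : T → ℝ}
    (h : Integrable (fun t : X.nonzeroSet => v t) γ) :
    X.theta γ v = ((∫ t : X.nonzeroSet, v t ∂γ : ℝ) : EReal) := by
  have h1 : ∫⁻ t : X.nonzeroSet, ENNReal.ofReal (v t) ∂γ ≠ ∞ := h.lintegral_lt_top.ne
  have h2 : ∫⁻ t : X.nonzeroSet, ENNReal.ofReal (-v t) ∂γ ≠ ∞ := h.neg.lintegral_lt_top.ne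
  rw [integral_eq_lintegral_pos_part_sub_lintegral_neg_part h, EReal.coe_sub,
    EReal.coe_ennreal_toReal h1, EReal.coe_ennreal_toReal h2, theta]

end Theta

end ContGaussianProcess

/-! ### The two bounds -/

theorem theorem2p2 {T Ω : Type*} [MetricSpace T] [CompactSpace T] [MeasurableSpace T]
    [BorelSpace T] [MeasurableSpace Ω] {P : Measure Ω} [IsProbabilityMeasure P]
    (X : ContGaussianProcess T Ω P) (u : T → ℝ) (hu : LowerSemicontinuous u)
    (f : X.HK) (γ : Measure X.nonzeroSet) [IsFiniteMeasure γ] :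
    ∃ fTilde : X.HK, (∀ t, fTilde t = X.covOp γ t) ∧
      (0 ≤ ∫ t : X.nonzeroSet, (f t - fTilde t) ∂γ →
        X.nonCrossing f u ≤
          X.nonCrossing (f - fTilde) u *
            EReal.exp (((-(1 / 2) * ‖fTilde‖ ^ 2 : ℝ) : EReal) + X.theta γ u)) ∧
      (∀ uMinus : T → ℝ, Continuous uMinus → (∀ t, uMinus t < u t) →
        0 < X.nonCrossingTwoSided u uMinus →
        (∀ t, f t ≤ fTilde t) →
        X.nonCrossingTwoSided u uMinus *
            EReal.exp (((-(1 / 2) * ‖fTilde‖ ^ 2 : ℝ) : EReal) + X.theta γ uMinus) ≤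
          X.nonCrossing f u) := by
  have hint : ∀ {F : T → ℝ}, Continuous F → Integrable (fun t : X.nonzeroSet => F t) γ :=
    fun hF => integrable_comp_of_continuous_of_compact γ
      measurable_subtype_coe hF
  set h : X.HK := ∫ s : X.nonzeroSet, X.covSection s ∂γ with hh
  set Y : Ω → ℝ := fun ω => ∫ s : X.nonzeroSet, X.val s ω ∂γ with hYdef
  have hY : X.IsPaleyWiener h Y := X.isPaleyWiener_integral γ measurable_subtype_coe
  have hf : Continuous f := X.continuous_coe_HK f
  have hhc : Continuous h := X.continuous_coe_HK h
  refine ⟨h, fun t => ?_, fun hG2 => ?_, fun v hv hvu hpos hG3 => ?_⟩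
  · rw [← X.inner_covSection, real_inner_comm, hh, ← integral_inner
      (integrable_comp_of_continuous_of_compact γ measurable_subtype_coe
        X.continuous_covSection)]
    refine integral_congr_ae (ae_of_all _ fun s => ?_)
    change ⟪X.covSection t, X.covSection s⟫ = X.cov t s
    rw [real_inner_comm, X.inner_covSection, X.covSection_apply, X.cov_comm]
  · set g : T → ℝ := f - h with hg
    have hgc : Continuous g := hf.sub hhc
    have hfg : (f : T → ℝ) = h + g := by simp [hg]
    have hA := X.nullMeasurableSet_nonCrossing u hgc
    rw [hfg, hY.nonCrossing_add u hgc, mul_comm, ContGaussianProcess.nonCrossing,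
      ← setLIntegral_const]
    refine lintegral_mono_ae ((ae_restrict_iff'₀ hA).2 ?_)
    filter_upwards [X.continuous_paths] with ω hω hωA
    rw [X.cmDensity_eq_exp]
    refine EReal.exp_monotone (add_le_add le_rfl ?_)
    -- Dropping the drift costs nothing because its integral is non-negative.
    have h1 : Y ω ≤ ∫ t : X.nonzeroSet, (X.val t ω + g t) ∂γ := by
      rw [integral_add (hint hω) (hint hgc)]
      exact le_add_of_nonneg_right hG2
    calc ((Y ω : ℝ) : EReal) ≤ ((∫ t : X.nonzeroSet, (X.val t ω + g t) ∂γ : ℝ) : EReal) :=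
          EReal.coe_le_coe_iff.2 h1
      _ = X.theta γ fun t => X.val t ω + g t :=
          (X.theta_eq_integral γ (v := fun t => X.val t ω + g t) (hint (hω.add hgc))).symm
      _ ≤ X.theta γ u := X.theta_mono γ hωA
  · -- On the two-sided event the Cameron-Martin density is at least the claimed factor `C`.
    set C := EReal.exp (((-(1 / 2) * ‖h‖ ^ 2 : ℝ) : EReal) + X.theta γ v)
    have hA := X.nullMeasurableSet_nonCrossing u (continuous_const (y := (0 : ℝ)))
    set A := {ω | ∀ t, X.val t ω + (0 : ℝ) ≤ u t}
    have hsub : X.nonCrossingTwoSided u v ≤ P.restrict A {ω | C ≤ X.cmDensity h Y ω} := by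
      rw [Measure.restrict_apply₀' hA]
      refine measure_mono_ae ?_
      filter_upwards [X.continuous_paths] with ω hω hωW
      refine ⟨?_, fun t => by simpa using (hωW t).2⟩
      change C ≤ X.cmDensity h Y ω
      rw [X.cmDensity_eq_exp]
      refine EReal.exp_monotone (add_le_add le_rfl ?_)
      exact (X.theta_mono γ fun t => (hωW t).1).trans_eq (X.theta_eq_integral γ (hint hω))
    -- Markov's inequality, in place of integrating `C` over the two-sided event.
    calc X.nonCrossingTwoSided u v * C
        ≤ C * P.restrict A {ω | C ≤ X.cmDensity h Y ω} := by
          rw [mul_comm]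
          gcongr
      _ ≤ ∫⁻ ω in A, X.cmDensity h Y ω ∂P :=
          mul_meas_ge_le_lintegral₀ hY.aemeasurable_cmDensity.restrict C
      _ = X.nonCrossing (⇑h + fun _ => (0 : ℝ)) u :=
          (hY.nonCrossing_add u continuous_const).symm
      _ ≤ X.nonCrossing f u := by
          refine measure_mono fun ω hω t => (add_le_add le_rfl (hG3 t)).trans ?_
          simpa using hω t
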